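/- Let $i$ be a positive integer such that $i(3i+1)$ is a perfect square (for example $i = 1, 16, 225$), and put \[ a=2(i+1)i,\qquad b=2(i+2)(i+1),\qquad c=4(2i^2+4i+1)(2i+3)(2i+1). \] Let $E$ be the curve \[ E:\quad y^2=(x+ab)(x+ac)(x+bc) \] over $\mathbb{Q}$ induced by the Diophantine triple $\{a,b,c\}$. Then $E$ is an elliptic curve and the rank of $E(\mathbb{Q})$ is at least $3$. More precisely, let \[ X=-4(4i^2+9i+4)(4i^2+9i+3)(i+1)^2 . \] There are rational numbers $r,s,t$ with $bc+1=r^2$, $ca+1=s^2$, $ab+1=t^2$, and a rational number $y$ such that $(X,y)$ lies on the shifted curve $y^2=x(x+ac-ab)(x+bc-ab)$, which is obtained from $E$ by replacing $x$ by $x-ab$; equivalently, $Q=(X-ab,\,y)$ lies on $E$. The points \[ P=(0,abc),\qquad S=(1,rst),\qquad Q=(X-ab,\,y) \] of $E(\mathbb{Q})$ are linearly independent over $\mathbb{Z}$. -/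

import Mathlib

/-- The elliptic curve `y² = (x + ab)(x + ac)(x + bc)` over `ℚ` induced by a triple `{a, b, c}`,
with the right-hand side multiplied out. -/
def inducedCurve (a b c : ℚ) : WeierstrassCurve ℚ where
  a₁ := 0
  a₂ := a * b + a * c + b * c
  a₃ := 0
  a₄ := a * b * c * (a + b + c)
  a₆ := (a * b * c) ^ 2

theorem inducedCurve_equation_iff (a b c x y : ℚ) :
    (inducedCurve a b c).toAffine.Equation x y ↔
      y ^ 2 = (x + a * b) * (x + a * c) * (x + b * c) := by
  rw [WeierstrassCurve.Affine.equation_iff]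
  simp only [inducedCurve]
  constructor <;> intro h <;> linear_combination h

/-- The curve `y² = x (x + ac - ab)(x + bc - ab)` over `ℚ`, obtained from `inducedCurve a b c`
by substituting `x - ab` for `x`. -/
def shiftedCurve (a b c : ℚ) : WeierstrassCurve ℚ where
  a₁ := 0
  a₂ := (a * c - a * b) + (b * c - a * b)
  a₃ := 0
  a₄ := (a * c - a * b) * (b * c - a * b)
  a₆ := 0

theorem shiftedCurve_equation_iff (a b c x y : ℚ) :
    (shiftedCurve a b c).toAffine.Equation x y ↔
      y ^ 2 = x * (x + a * c - a * b) * (x + b * c - a * b) := by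
  rw [WeierstrassCurve.Affine.equation_iff]
  simp only [shiftedCurve]
  constructor <;> intro h <;> linear_combination h

theorem shiftedCurve_equation_iff_inducedCurve (a b c x y : ℚ) :
    (shiftedCurve a b c).toAffine.Equation x y ↔
      (inducedCurve a b c).toAffine.Equation (x - a * b) y := by
  rw [shiftedCurve_equation_iff, inducedCurve_equation_iff]
  constructor <;> intro h <;> linear_combination h

/-!
Write `n = i + 1`. Since `i` and `3 * i + 1` are coprime with square product, `n - 1 = u ^ 2` and
`3 * n - 2 = v ^ 2`; the first makes `n` and `4 * n ^ 2 + n - 1` lie strictly between consecutive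
squares, and the second makes `X` the abscissa of a rational point.

The proof is a 2-descent. As `S` is twice the point `R` with abscissa `rs + rt + st + 1`
(`inducedCurve_half_add_half`), it suffices that `P`, `R`, `Q` are independent. For a rational
2-torsion point `(e, 0)`, the map `(x, y) ↦ x - e` is a homomorphism from the group of points to
`ℚˣ` modulo squares (`isSquare_descentValue_add`), so it is trivial on doubles. By infinite descent
(`linearIndependent_int_of_descent`) it is enough that a sum of a subset of `{P, R, Q}` and of a
2-torsion point is a double only if the subset is empty and the torsion point is zero; the torsion
point is included in order to exclude relations that hold up to points of 2-power order.

The descent maps at `e = -ab` and `e = -ac` suffice. Up to squares, all the values are products of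
`n`, `n + 1`, `2 * n - 1`, `2 * n + 1`, `D = 2 * n ^ 2 - 1`, `α = 4 * n ^ 2 + n - 1`, `β = α - 1`,
`γ = 4 * n ^ 2 - n - 1` and `δ = γ - 1`, which are almost pairwise coprime: a factor that is prime
to the rest of a square is itself a square. The sign of the first value, and the facts that
`2 * n + 1`, `α` and `n` are not squares, nor `D` for even `n`, exclude every nontrivial combination
(`descent_arithmetic`).
-/

/-! ### Integral independence from a descent condition -/

/-- Elements of an abelian group are independent over `ℤ` if they are independent modulo doubles,
even after adding an element killed by `2`, and no nonzero element killed by `2` is a double. -/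
theorem linearIndependent_int_of_descent {ι G : Type*} [Fintype ι] [AddCommGroup G] (v : ι → G)
    (h : ∀ (ε : ι → ℕ) (T U : G), (∀ i, ε i < 2) → T + T = 0 → (∑ i, ε i • v i) + T = U + U →
      (∀ i, ε i = 0) ∧ T = 0) :
    LinearIndependent ℤ v := by
  -- The hypothesis for arbitrary integral coefficients, which may be reduced modulo `2`.
  have parity : ∀ (c : ι → ℤ) (T U : G), T + T = 0 → (∑ i, c i • v i) + T = U + U →
      (∀ i, c i = 2 * (c i / 2)) ∧ T = 0 := by
    intro c T U hT hc
    have key : ∀ i, c i • v i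
        = (c i % 2).toNat • v i + ((c i / 2) • v i + (c i / 2) • v i) := by
      intro i
      rw [← natCast_zsmul, Int.toNat_of_nonneg (Int.emod_nonneg _ two_ne_zero), ← add_smul,
        ← add_smul]
      congr 1
      omega
    simp only [key, Finset.sum_add_distrib] at hc
    obtain ⟨h0, hT0⟩ := h (fun i ↦ (c i % 2).toNat) T (U - ∑ i, (c i / 2) • v i)
      (fun i ↦ by omega) hT (by
        rw [sub_add_sub_comm, ← hc]
        abel)
    refine ⟨fun i ↦ ?_, hT0⟩
    have : (c i % 2).toNat = 0 := h0 i
    omega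
  -- A relation among the `v i` has even coefficients; half of it has a value killed by `2`, which
  -- vanishes as well.
  have step : ∀ c : ι → ℤ, ∑ i, c i • v i = 0 →
      ∃ c' : ι → ℤ, (∀ i, c i = 2 * c' i) ∧ ∑ i, c' i • v i = 0 := by
    intro c hc
    have heven := (parity c 0 0 (add_zero 0) (by simp [hc])).1
    have h2 : (∑ i, (c i / 2) • v i) + ∑ i, (c i / 2) • v i = 0 := by
      rw [← hc, ← Finset.sum_add_distrib]
      refine Finset.sum_congr rfl fun i _ ↦ ?_
      rw [← add_smul, ← two_mul, ← heven i]
    refine ⟨fun i ↦ c i / 2, heven, ?_⟩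
    rw [← neg_eq_zero]
    exact (parity (fun i ↦ c i / 2) (-∑ i, (c i / 2) • v i) 0 (by rw [← neg_add, h2, neg_zero])
      (by simp)).2
  have hdvd : ∀ (k : ℕ) (c : ι → ℤ), ∑ i, c i • v i = 0 → ∀ i, (2 : ℤ) ^ k ∣ c i := by
    intro k
    induction k with
    | zero => intro c _ i; simp
    | succ k ih =>
      intro c hc i
      obtain ⟨c', hcc', hc'⟩ := step c hc
      rw [hcc' i, pow_succ']
      exact mul_dvd_mul_left 2 (ih c' hc' i)
  rw [Fintype.linearIndependent_iff]
  intro c hc i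
  refine Int.eq_zero_of_abs_lt_dvd (hdvd (c i).natAbs c hc i) ?_
  rw [← Int.natCast_natAbs]
  exact_mod_cast Nat.lt_two_pow_self

/-! ### The descent map at a rational 2-torsion point -/

theorem isSquare_of_isSquare_sq_mul {F : Type*} [Field F] {z k m : F} (hz : z ≠ 0)
    (h : IsSquare m) (hm : m = z ^ 2 * k) : IsSquare k := by
  obtain ⟨d, hd⟩ := h
  exact ⟨d / z, by field_simp; linear_combination hd - hm⟩

/-- The computation behind the additivity of the descent map. If the points with abscissae
`e + uᵢ` are the intersections of the curve with a line of slope `ℓ` and value `m` at `e`, and `κ`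
is the derivative at `e` of the cubic, the hypotheses compare at `e` the values and the derivatives
of `∏ (X - e - uᵢ)` and of the cubic minus the square of the line. -/
theorem isSquare_mul_ite_of_collinear {F : Type*} [Field F] {κ u₁ u₂ u₃ ℓ m : F}
    [DecidableEq F] (hκ : κ ≠ 0) (h0 : u₁ * u₂ * u₃ = m ^ 2)
    (h1 : u₁ * u₂ + u₁ * u₃ + u₂ * u₃ = κ - 2 * ℓ * m) :
    IsSquare ((if u₃ = 0 then κ else u₃) *
      ((if u₁ = 0 then κ else u₁) * (if u₂ = 0 then κ else u₂))) := by
  by_cases hm : m = 0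
  · subst hm
    have h1' : κ = u₁ * u₂ + u₁ * u₃ + u₂ * u₃ := by linear_combination -h1
    -- Exactly one of the `uᵢ` vanishes, and then `κ` is the product of the other two.
    have h0' : (u₁ = 0 ∨ u₂ = 0) ∨ u₃ = 0 := by simpa using h0
    rcases h0' with (rfl | rfl) | rfl
    · have h2 : u₂ ≠ 0 := by rintro rfl; simp at h1'; exact hκ h1'
      have h3 : u₃ ≠ 0 := by rintro rfl; simp at h1'; exact hκ h1'
      simp only [if_true, h2, h3, if_false]
      exact ⟨u₂ * u₃, by rw [h1']; ring⟩
    · have h2 : u₁ ≠ 0 := by rintro rfl; simp at h1'; exact hκ h1'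
      have h3 : u₃ ≠ 0 := by rintro rfl; simp at h1'; exact hκ h1'
      simp only [if_true, h2, h3, if_false]
      exact ⟨u₁ * u₃, by rw [h1']; ring⟩
    · have h2 : u₁ ≠ 0 := by rintro rfl; simp at h1'; exact hκ h1'
      have h3 : u₂ ≠ 0 := by rintro rfl; simp at h1'; exact hκ h1'
      simp only [if_true, h2, h3, if_false]
      exact ⟨u₁ * u₂, by rw [h1']; ring⟩
  · have hne : u₁ * u₂ * u₃ ≠ 0 := by rw [h0]; exact pow_ne_zero 2 hm
    have h3 : u₃ ≠ 0 := right_ne_zero_of_mul hne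
    have h12 := left_ne_zero_of_mul hne
    simp only [left_ne_zero_of_mul h12, right_ne_zero_of_mul h12, h3, if_false]
    exact ⟨m, by linear_combination h0⟩

namespace WeierstrassCurve.Affine

variable {F : Type*} [Field F] [DecidableEq F]

/-- A representative in `F` of the value of the 2-descent map attached to a root `e` of the cubic
`x ^ 3 + a₂ x ^ 2 + a₄ x + a₆`, for a curve with `a₁ = a₃ = 0`: it is `x - e` at a point `(x, y)`
with `x ≠ e`, the derivative of the cubic at `e` if `x = e`, and `1` at infinity. -/
def descentValue (W : WeierstrassCurve.Affine F) (e : F) : W.Point → F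
  | .zero => 1
  | .some x _ _ => if x - e = 0 then 3 * e ^ 2 + 2 * W.a₂ * e + W.a₄ else x - e

variable {W : WeierstrassCurve.Affine F} {e : F}

theorem descentValue_zero : descentValue W e 0 = 1 := rfl

theorem descentValue_some {x y : F} (h : W.Nonsingular x y) (hx : x ≠ e) :
    descentValue W e (.some x y h) = x - e :=
  if_neg (sub_ne_zero.2 hx)

theorem descentValue_some_self {y : F} (h : W.Nonsingular e y) :
    descentValue W e (.some e y h) = 3 * e ^ 2 + 2 * W.a₂ * e + W.a₄ :=
  if_pos (sub_self e)

theorem descentValue_ne_zero (hκ : 3 * e ^ 2 + 2 * W.a₂ * e + W.a₄ ≠ 0) (P : W.Point) :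
    descentValue W e P ≠ 0 := by
  rcases P with _ | ⟨x, y, h⟩
  · exact one_ne_zero
  · by_cases hx : x - e = 0
    · simpa only [descentValue, hx, if_true] using hκ
    · rwa [descentValue, if_neg hx]

/-- The descent value is additive modulo squares. -/
theorem isSquare_descentValue_add (h₁ : W.a₁ = 0) (h₃ : W.a₃ = 0)
    (he : e ^ 3 + W.a₂ * e ^ 2 + W.a₄ * e + W.a₆ = 0)
    (hκ : 3 * e ^ 2 + 2 * W.a₂ * e + W.a₄ ≠ 0) (P Q : W.Point) :
    IsSquare (descentValue W e (P + Q) * (descentValue W e P * descentValue W e Q)) := by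
  rcases P with _ | ⟨x₁, y₁, hP⟩
  · rw [← Point.zero_def, zero_add, descentValue_zero, one_mul]
    exact IsSquare.mul_self _
  rcases Q with _ | ⟨x₂, y₂, hQ⟩
  · rw [← Point.zero_def, add_zero, descentValue_zero, mul_one]
    exact IsSquare.mul_self _
  by_cases hxy : x₁ = x₂ ∧ y₁ = W.negY x₂ y₂
  · rw [Point.add_of_Y_eq hxy.1 hxy.2, descentValue_zero, one_mul]
    simp only [descentValue, hxy.1]
    exact IsSquare.mul_self _
  rw [Point.add_some hxy]
  have hpoly := addPolynomial_slope hP.1 hQ.1 hxy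
  set ℓ := W.slope x₁ x₂ y₁ y₂
  set x₃ := W.addX x₁ x₂ ℓ
  rw [addPolynomial_eq, neg_inj, Cubic.prod_X_sub_C_eq, Cubic.toPoly_injective] at hpoly
  simp only [Cubic.mk.injEq, h₁, h₃] at hpoly
  obtain ⟨-, hb, hc, hd⟩ := hpoly
  refine isSquare_mul_ite_of_collinear (ℓ := ℓ) (m := ℓ * (e - x₁) + y₁) hκ ?_ ?_
  · linear_combination hd + e * hc + e ^ 2 * hb - he
  · linear_combination -hc - 2 * e * hb

/-- If a sum of four points is a double, the product of their descent values is a square. -/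
theorem isSquare_descentValue_add_three (h₁ : W.a₁ = 0) (h₃ : W.a₃ = 0)
    (he : e ^ 3 + W.a₂ * e ^ 2 + W.a₄ * e + W.a₆ = 0)
    (hκ : 3 * e ^ 2 + 2 * W.a₂ * e + W.a₄ ≠ 0) {A B C T U : W.Point}
    (h : A + B + C + T = U + U) :
    IsSquare (descentValue W e A * descentValue W e B * descentValue W e C *
      descentValue W e T) := by
  have hne := descentValue_ne_zero (W := W) hκ
  have key := isSquare_descentValue_add h₁ h₃ he hκ
  have hU := key (A + B + C) T
  rw [h] at hU
  refine isSquare_of_isSquare_sq_mul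
    (z := descentValue W e (A + B) * descentValue W e (A + B + C) * descentValue W e (U + U) *
      descentValue W e U)
    (mul_ne_zero (mul_ne_zero (mul_ne_zero (hne _) (hne _)) (hne _)) (hne _))
    (((key A B).mul (key (A + B) C)).mul (hU.mul (key U U))) ?_
  ring

theorem descentValue_nsmul {k : ℕ} (hk : k < 2) (P : W.Point) :
    descentValue W e (k • P) = descentValue W e P ^ k := by
  interval_cases k
  · rw [zero_smul, pow_zero, descentValue_zero]
  · rw [one_smul, pow_one]

end WeierstrassCurve.Affine

/-! ### Squares among coprime factors and the descent computation -/

theorem Int.isSquare_of_isCoprime_of_isSquare_mul {a b : ℤ} (ha : 0 < a) (hab : IsCoprime a b)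
    (h : IsSquare (a * b)) : IsSquare a := by
  obtain ⟨c, hc⟩ := h
  obtain ⟨d, hd | hd⟩ := Int.sq_of_isCoprime hab (hc.trans (sq c).symm)
  · exact ⟨d, hd.trans (sq d)⟩
  · nlinarith [sq_nonneg d]

theorem not_isSquare_of_sq_lt_of_lt_sq {a m : ℤ} (hm : 0 ≤ m) (h1 : m ^ 2 < a)
    (h2 : a < (m + 1) ^ 2) : ¬ IsSquare a := by
  rintro ⟨d, rfl⟩
  rw [← sq, ← sq_abs d] at h1 h2
  have := lt_of_pow_lt_pow_left₀ 2 (abs_nonneg d) h1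
  have := lt_of_pow_lt_pow_left₀ 2 (by omega) h2
  omega

theorem isSquare_of_isSquare_sq_mul_int {z k m : ℤ} (hz : z ≠ 0)
    (h : IsSquare m) (hm : m = z ^ 2 * k) : IsSquare k := by
  rw [← Rat.isSquare_intCast_iff] at h ⊢
  exact isSquare_of_isSquare_sq_mul (z := (z : ℚ)) (by exact_mod_cast hz) h (by exact_mod_cast hm)

/-- The hypotheses `h1` and `h2` say that the descent values at `-ab` and `-ac` of a combination of
`P`, `R`, `Q` with exponents `p`, `r`, `q` and of the 2-torsion points `(-ab, 0)`, `(-ac, 0)` with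
exponents `t`, `s` are squares, after removal of square factors. -/
theorem descent_arithmetic {n u α β γ δ D : ℤ} (hu : 0 < u) (hn : n = u ^ 2 + 1)
    (hα : α = 4 * n ^ 2 + n - 1) (hβ : β = 4 * n ^ 2 + n - 2) (hγ : γ = 4 * n ^ 2 - n - 1)
    (hδ : δ = 4 * n ^ 2 - n - 2) (hD : D = 2 * n ^ 2 - 1)
    {p r q t s : ℕ} (hp : p < 2) (hr : r < 2) (hq : q < 2) (ht : t < 2) (hs : s < 2)
    (h1 : IsSquare ((n + 1) ^ p * (n * (n + 1) * γ * δ) ^ r * (-(α * β)) ^ q *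
      (((n + 1) * α * β * γ * δ) ^ t * (-(n * α * δ)) ^ s)))
    (h2 : IsSquare ((2 * n * D * (2 * n - 1) * (2 * n + 1)) ^ p * (D * δ) ^ r *
      (-(n * α * (2 * n + 1))) ^ q *
      ((n * α * δ) ^ t * (-(α * δ * D * (2 * n - 1) * (2 * n + 1))) ^ s))) :
    p = 0 ∧ r = 0 ∧ q = 0 ∧ t = 0 ∧ s = 0 := by
  have hn2 : 2 ≤ n := by nlinarith
  have hα0 : 0 < α := by rw [hα]; nlinarith
  have hβ0 : 0 < β := by rw [hβ]; nlinarith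
  have hγ0 : 0 < γ := by rw [hγ]; nlinarith
  have hδ0 : 0 < δ := by rw [hδ]; nlinarith
  have hD0 : 0 < D := by rw [hD]; nlinarith
  have hn1 : 0 < n + 1 := by omega
  have hn0 : 0 < n := by omega
  have hm0 : 0 < 2 * n - 1 := by omega
  have hk0 : 0 < 2 * n + 1 := by omega
  -- The first component has sign `(-1) ^ (q + s)`.
  have hqs : q = s := by
    have := h1.nonneg
    by_contra hne
    rcases (by omega : q = 1 ∧ s = 0 ∨ q = 0 ∧ s = 1) with ⟨rfl, rfl⟩ | ⟨rfl, rfl⟩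
    · have : 0 < (n + 1) ^ p * (n * (n + 1) * γ * δ) ^ r * (α * β) *
        ((n + 1) * α * β * γ * δ) ^ t := by positivity
      linarith
    · have : 0 < (n + 1) ^ p * (n * (n + 1) * γ * δ) ^ r * (n * α * δ) *
        ((n + 1) * α * β * γ * δ) ^ t := by positivity
      linarith
  subst hqs
  have cop : ∀ {x y : ℤ}, (∃ f g : ℤ, f * x + g * y = 1) → IsCoprime x y := id
  -- `n = u ^ 2 + 1` and `α` lie strictly between consecutive squares.
  have n_nsq : ¬ IsSquare n :=
    not_isSquare_of_sq_lt_of_lt_sq hu.le (by rw [hn]; linarith) (by rw [hn]; linarith)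
  have α_nsq : ¬ IsSquare α :=
    not_isSquare_of_sq_lt_of_lt_sq (m := 2 * n) (by omega) (by rw [hα]; linarith)
      (by rw [hα]; linarith)
  -- `2 * n + 1 = 2 * u ^ 2 + 3` is congruent to `3` or `5` modulo `8`.
  have k_nsq : ¬ IsSquare (2 * n + 1) := by
    rintro ⟨d, hd⟩
    have h : (2 * u ^ 2 + 3 : ZMod 8) = d * d := by
      have : ((2 * n + 1 : ℤ) : ZMod 8) = ((d * d : ℤ) : ZMod 8) := by rw [hd]
      rw [hn] at this
      push_cast at this
      rw [← this]; ring
    revert h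
    generalize (u : ZMod 8) = x
    generalize (d : ZMod 8) = y
    revert x y
    decide
  have nα : IsCoprime n α := cop ⟨4 * n + 1, -1, by rw [hα]; ring⟩
  have nD : IsCoprime n D := cop ⟨2 * n, -1, by rw [hD]; ring⟩
  have nm : IsCoprime n (2 * n - 1) := cop ⟨2, -1, by ring⟩
  have nγ : IsCoprime n γ := cop ⟨4 * n - 1, -1, by rw [hγ]; ring⟩
  have nn1 : IsCoprime n (n + 1) := cop ⟨-1, 1, by ring⟩
  have kn : IsCoprime (2 * n + 1) n := cop ⟨1, -2, by ring⟩
  have k2 : IsCoprime (2 * n + 1) 2 := cop ⟨1, -n, by ring⟩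
  have km : IsCoprime (2 * n + 1) (2 * n - 1) := cop ⟨1 - n, n, by ring⟩
  have kD : IsCoprime (2 * n + 1) D := cop ⟨2 * n - 1, -2, by rw [hD]; ring⟩
  have kα : IsCoprime (2 * n + 1) α := cop ⟨4 * n - 1, -2, by rw [hα]; ring⟩
  have kδ : IsCoprime (2 * n + 1) δ := cop ⟨4 * n - 3, -2, by rw [hδ]; ring⟩
  have αD : IsCoprime α D := cop ⟨-2 * (n - 1), 4 * n - 3, by rw [hα, hD]; ring⟩
  have αm : IsCoprime α (2 * n - 1) := cop ⟨2, -(4 * n + 3), by rw [hα]; ring⟩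
  have αδ : IsCoprime α δ := cop ⟨4 * n - 3, -(4 * n - 1), by rw [hα, hδ]; ring⟩
  have Dm : IsCoprime D (2 * n - 1) := cop ⟨-2, 2 * n + 1, by rw [hD]; ring⟩
  have Dδ : IsCoprime D δ := cop ⟨4 * n - 1, -2 * n, by rw [hD, hδ]; ring⟩
  have h2' : IsSquare ((2 * n * D * (2 * n - 1) * (2 * n + 1)) ^ p * (D * δ) ^ r *
      (n * α * δ) ^ t * (n * δ * D * (2 * n - 1)) ^ q) := by
    refine isSquare_of_isSquare_sq_mul_int (z := (α * (2 * n + 1)) ^ q) (by positivity) h2 ?_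
    rcases (by omega : q = 0 ∨ q = 1) with rfl | rfl <;> ring
  -- `2 * n + 1` is prime to the other factors of the second value.
  have p0 : p = 0 := by
    by_contra hp0
    obtain rfl : p = 1 := by omega
    refine k_nsq (Int.isSquare_of_isCoprime_of_isSquare_mul hk0
      (b := 2 * n * D * (2 * n - 1) * (D * δ) ^ r * (n * α * δ) ^ t *
        (n * δ * D * (2 * n - 1)) ^ q) ?_ ?_)
    · exact (((((k2.mul_right kn).mul_right kD).mul_right km).mul_right
        (kD.mul_right kδ).pow_right).mul_right ((kn.mul_right kα).mul_right kδ).pow_right).mul_right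
        (((kn.mul_right kδ).mul_right kD).mul_right km).pow_right
    · convert h2' using 1
      ring
  subst p0
  -- With `p = 0`, so is `α`.
  have t0 : t = 0 := by
    by_contra ht0
    obtain rfl : t = 1 := by omega
    refine α_nsq (Int.isSquare_of_isCoprime_of_isSquare_mul hα0
      (b := n * δ * (D * δ) ^ r * (n * δ * D * (2 * n - 1)) ^ q) ?_ ?_)
    · exact ((nα.symm.mul_right αδ).mul_right (αD.mul_right αδ).pow_right).mul_right
        (((nα.symm.mul_right αδ).mul_right αD).mul_right αm).pow_right
    · convert h2' using 1
      ring
  subst t0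
  -- If `D` is a square, then `n` is odd, since `D` is `3` modulo `4` for even `n`; this makes `n`
  -- prime to `δ` and `β`.
  have n_odd : IsSquare D → IsCoprime n δ ∧ IsCoprime n β := by
    rintro ⟨d, hd⟩
    obtain ⟨k, hk | hk⟩ := n.even_or_odd'
    · exfalso
      have h : (3 : ZMod 4) = d * d := by
        have : ((D : ℤ) : ZMod 4) = ((d * d : ℤ) : ZMod 4) := by rw [hd]
        rw [hD, hk, show 2 * (2 * k) ^ 2 - 1 = 4 * (2 * k ^ 2 - 1) + 3 by ring] at this
        push_cast at this
        rw [← this, show (4 : ZMod 4) = 0 by decide]; ring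
      revert h
      generalize (d : ZMod 4) = y
      revert y
      decide
    · have n2 : IsCoprime n 2 := cop ⟨1, -k, by rw [hk]; ring⟩
      constructor
      · rw [hδ, show 4 * n ^ 2 - n - 2 = -2 + n * (4 * n - 1) by ring]
        exact IsCoprime.add_mul_left_right n2.neg_right _
      · rw [hβ, show 4 * n ^ 2 + n - 2 = -2 + n * (4 * n + 1) by ring]
        exact IsCoprime.add_mul_left_right n2.neg_right _
  -- In each remaining nontrivial case `n` would be a square.
  refine ⟨rfl, ?_⟩
  rcases (by omega : r = 0 ∧ q = 0 ∨ r = 1 ∧ q = 0 ∨ r = 0 ∧ q = 1 ∨ r = 1 ∧ q = 1) with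
    ⟨rfl, rfl⟩ | ⟨rfl, rfl⟩ | ⟨rfl, rfl⟩ | ⟨rfl, rfl⟩
  · simp
  · exfalso
    have hDδ : IsSquare (D * δ) := by simpa using h2'
    have hnδ := n_odd (Int.isSquare_of_isCoprime_of_isSquare_mul hD0 Dδ hDδ)
    refine n_nsq (Int.isSquare_of_isCoprime_of_isSquare_mul hn0 (b := (n + 1) * γ * δ)
      ((nn1.mul_right nγ).mul_right hnδ.1) ?_)
    convert h1 using 1
    ring
  · exfalso
    have h : IsSquare (D * (n * δ * (2 * n - 1))) := by
      convert h2' using 1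
      ring
    have hnδ := n_odd (Int.isSquare_of_isCoprime_of_isSquare_mul hD0
      ((nD.symm.mul_right Dδ).mul_right Dm) h)
    refine n_nsq (Int.isSquare_of_isCoprime_of_isSquare_mul hn0 (b := δ * β)
      (hnδ.1.mul_right hnδ.2) ?_)
    exact isSquare_of_isSquare_sq_mul_int (z := α) (by positivity) h1 (by ring)
  · exfalso
    refine n_nsq (Int.isSquare_of_isCoprime_of_isSquare_mul hn0 nm ?_)
    exact isSquare_of_isSquare_sq_mul_int (z := D * δ) (by positivity) h2' (by ring)

/-! ### The curve induced by a triple -/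

theorem inducedCurve_isElliptic {a b c : ℚ} (ha : a ≠ 0) (hb : b ≠ 0) (hc : c ≠ 0) (hab : a ≠ b)
    (hac : a ≠ c) (hbc : b ≠ c) : (inducedCurve a b c).IsElliptic := by
  rw [WeierstrassCurve.isElliptic_iff, isUnit_iff_ne_zero]
  have h : (inducedCurve a b c).Δ = (4 * a * b * c * (a - b) * (a - c) * (b - c)) ^ 2 := by
    simp only [inducedCurve, WeierstrassCurve.Δ, WeierstrassCurve.b₂, WeierstrassCurve.b₄,
      WeierstrassCurve.b₆, WeierstrassCurve.b₈]
    ring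
  rw [h]
  have := sub_ne_zero.2 hab
  have := sub_ne_zero.2 hac
  have := sub_ne_zero.2 hbc
  positivity

theorem inducedCurve_eq_of_add_self_eq_zero {a b c : ℚ} {T : (inducedCurve a b c).toAffine.Point}
    (hT : T + T = 0) :
    T = 0 ∨ ∃ x h, T = .some x 0 h ∧ (x = -(a * b) ∨ x = -(a * c) ∨ x = -(b * c)) := by
  rcases T with _ | ⟨x, y, h⟩
  · exact Or.inl rfl
  · right
    have hy : y = 0 := by
      by_contra hy
      have hne : y ≠ (inducedCurve a b c).toAffine.negY x y := by
        simp only [WeierstrassCurve.Affine.negY, inducedCurve]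
        intro h
        exact hy (by linarith)
      rw [WeierstrassCurve.Affine.Point.add_self_of_Y_ne hne] at hT
      exact WeierstrassCurve.Affine.Point.some_ne_zero _ hT
    subst hy
    refine ⟨x, h, rfl, ?_⟩
    have heq := (inducedCurve_equation_iff a b c x 0).1 h.1
    have : (x + a * b = 0 ∨ x + a * c = 0) ∨ x + b * c = 0 := by
      simpa using heq.symm
    rcases this with (h | h) | h
    · exact Or.inl (by linarith)
    · exact Or.inr (Or.inl (by linarith))
    · exact Or.inr (Or.inr (by linarith))

/-- With `bc + 1`, `ca + 1`, `ab + 1` squares, the curve has a point whose abscissa exceeds each of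
the roots of the cubic by a product of two of `r + s`, `s + t`, `t + r`. -/
theorem inducedCurve_equation_half {a b c r s t : ℚ} (hr : b * c + 1 = r ^ 2)
    (hs : c * a + 1 = s ^ 2) (ht : a * b + 1 = t ^ 2) :
    (inducedCurve a b c).toAffine.Equation (r * s + r * t + s * t + 1)
      ((r + s) * (s + t) * (t + r)) := by
  rw [inducedCurve_equation_iff,
    show r * s + r * t + s * t + 1 + a * b = (t + r) * (s + t) by linear_combination ht,
    show r * s + r * t + s * t + 1 + a * c = (r + s) * (s + t) by linear_combination hs,
    show r * s + r * t + s * t + 1 + b * c = (r + s) * (t + r) by linear_combination hr]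
  ring

/-- The point with abscissa `1` is twice the point of `inducedCurve_equation_half`. -/
theorem inducedCurve_half_add_half {a b c r s t : ℚ} (hr : b * c + 1 = r ^ 2)
    (hs : c * a + 1 = s ^ 2) (ht : a * b + 1 = t ^ 2)
    (hne : (r + s) * (s + t) * (t + r) ≠ 0)
    (hR : (inducedCurve a b c).toAffine.Nonsingular (r * s + r * t + s * t + 1)
      ((r + s) * (s + t) * (t + r)))
    (hS : (inducedCurve a b c).toAffine.Nonsingular 1 (r * s * t)) :
    WeierstrassCurve.Affine.Point.some _ _ hR + WeierstrassCurve.Affine.Point.some _ _ hR =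
      WeierstrassCurve.Affine.Point.some _ _ hS := by
  have hneg : (r + s) * (s + t) * (t + r) ≠ (inducedCurve a b c).toAffine.negY
      (r * s + r * t + s * t + 1) ((r + s) * (s + t) * (t + r)) := by
    simp only [WeierstrassCurve.Affine.negY, inducedCurve]
    intro h
    exact hne (by linarith)
  rw [WeierstrassCurve.Affine.Point.add_self_of_Y_ne hneg]
  -- The tangent at the half point has slope `r + s + t`.
  have hslope : (inducedCurve a b c).toAffine.slope (r * s + r * t + s * t + 1)
      (r * s + r * t + s * t + 1) ((r + s) * (s + t) * (t + r)) ((r + s) * (s + t) * (t + r)) =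
      r + s + t := by
    rw [WeierstrassCurve.Affine.slope_of_Y_ne rfl hneg]
    simp only [WeierstrassCurve.Affine.negY, inducedCurve]
    rw [div_eq_iff (by intro h; exact hne (by linarith))]
    set x := r * s + r * t + s * t + 1 with hx
    have h1 : x + a * b = (t + r) * (s + t) := by linear_combination hx + ht
    have h2 : x + a * c = (r + s) * (s + t) := by linear_combination hx + hs
    have h3 : x + b * c = (r + s) * (t + r) := by linear_combination hx + hr
    calc _ = (x + a * b) * (x + a * c) + (x + a * b) * (x + b * c) +
          (x + a * c) * (x + b * c) := by ring
      _ = _ := by rw [h1, h2, h3]; ring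
  have hX : (inducedCurve a b c).toAffine.addX (r * s + r * t + s * t + 1)
      (r * s + r * t + s * t + 1) (r + s + t) = 1 := by
    simp only [WeierstrassCurve.Affine.addX, inducedCurve]
    linear_combination -hr - hs - ht
  rw [WeierstrassCurve.Affine.Point.some.injEq, hslope]
  refine ⟨hX, ?_⟩
  simp only [WeierstrassCurve.Affine.addY, WeierstrassCurve.Affine.negAddY, hX]
  simp only [WeierstrassCurve.Affine.negY, inducedCurve]
  ring

/-! ### Independence in the family -/

open WeierstrassCurve.Affine in
/-- Independence of `P`, of half of `S`, and of `Q`, in terms of `n = i + 1`. -/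
theorem linearIndependent_family {n u v : ℤ} (hu : 0 < u) (hv : 0 < v) (hn : n = u ^ 2 + 1)
    (hnv : 3 * n - 2 = v ^ 2) {a b c r s t y : ℚ}
    (ha : a = 2 * n * (n - 1)) (hb : b = 2 * n * (n + 1))
    (hc : c = 4 * (2 * n ^ 2 - 1) * (2 * n - 1) * (2 * n + 1))
    (hr : r = 8 * n ^ 3 + 4 * n ^ 2 - 4 * n - 1) (hs : s = 8 * n ^ 3 - 4 * n ^ 2 - 4 * n + 1)
    (ht : t = 2 * n ^ 2 - 1)
    (hP : (inducedCurve a b c).toAffine.Nonsingular 0 (a * b * c))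
    (hR : (inducedCurve a b c).toAffine.Nonsingular (r * s + r * t + s * t + 1)
      ((r + s) * (s + t) * (t + r)))
    (hQ : (inducedCurve a b c).toAffine.Nonsingular
      (-4 * (4 * n ^ 2 + n - 1) * (4 * n ^ 2 + n - 2) * n ^ 2 - a * b) y) :
    LinearIndependent ℤ ![Point.some _ _ hP, Point.some _ _ hR, Point.some _ _ hQ] := by
  have hn2 : (2 : ℚ) ≤ n := by exact_mod_cast (by nlinarith : (2 : ℤ) ≤ n)
  have hu' : (0 : ℚ) < u := by exact_mod_cast hu
  have hv' : (0 : ℚ) < v := by exact_mod_cast hv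
  have hnu : (n : ℚ) - 1 = u ^ 2 := by rw [hn]; push_cast; ring
  have hnv' : 3 * (n : ℚ) - 2 = v ^ 2 := by exact_mod_cast hnv
  obtain ⟨N, hN⟩ : ∃ N : ℚ, N = n := ⟨_, rfl⟩
  obtain ⟨α, hα⟩ : ∃ α : ℚ, α = 4 * N ^ 2 + N - 1 := ⟨_, rfl⟩
  obtain ⟨β, hβ⟩ : ∃ β : ℚ, β = 4 * N ^ 2 + N - 2 := ⟨_, rfl⟩
  obtain ⟨γ, hγ⟩ : ∃ γ : ℚ, γ = 4 * N ^ 2 - N - 1 := ⟨_, rfl⟩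
  obtain ⟨δ, hδ⟩ : ∃ δ : ℚ, δ = 4 * N ^ 2 - N - 2 := ⟨_, rfl⟩
  obtain ⟨D, hD⟩ : ∃ D : ℚ, D = 2 * N ^ 2 - 1 := ⟨_, rfl⟩
  rw [← hN] at ha hb hc hr hs ht hn2 hnu hnv'
  have hα0 : 0 < α := by rw [hα]; nlinarith
  have hβ0 : 0 < β := by rw [hβ]; nlinarith
  have hγ0 : 0 < γ := by rw [hγ]; nlinarith
  have hδ0 : 0 < δ := by rw [hδ]; nlinarith
  have hD0 : 0 < D := by rw [hD]; nlinarith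
  have hN0 : 0 < N := by linarith
  have hN1 : 0 < N + 1 := by linarith
  have hm0 : 0 < 2 * N - 1 := by linarith
  have hk0 : 0 < 2 * N + 1 := by linarith
  -- The differences entering the descent values, with their square factors split off.
  have hab : a * b = (2 * N * u) ^ 2 * (N + 1) := by
    rw [ha, hb]; linear_combination 4 * N ^ 2 * (N + 1) * hnu
  have hac : a * c = (2 * u) ^ 2 * (2 * N * D * (2 * N - 1) * (2 * N + 1)) := by
    rw [ha, hc, hD]
    linear_combination 8 * N * (2 * N ^ 2 - 1) * (2 * N - 1) * (2 * N + 1) * hnu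
  have hA : a * c - a * b = (2 * u) ^ 2 * (N * α * δ) := by
    rw [ha, hb, hc, hα, hδ]
    linear_combination 4 * N * (4 * N ^ 2 + N - 1) * (4 * N ^ 2 - N - 2) * hnu
  have hB : b * c - a * b = 2 ^ 2 * (N * (N + 1) * β * γ) := by
    rw [ha, hb, hc, hβ, hγ]; ring
  have hAB : b * c - a * c = 4 ^ 2 * (N * D * (2 * N - 1) * (2 * N + 1)) := by
    rw [ha, hb, hc, hD]; ring
  have hx1 : r * s + r * t + s * t + 1 + a * b = 2 ^ 2 * (N * (N + 1) * γ * δ) := by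
    rw [ha, hb, hr, hs, ht, hγ, hδ]; ring
  have hx2 : r * s + r * t + s * t + 1 + a * c = (4 * N) ^ 2 * (D * δ) := by
    rw [ha, hc, hr, hs, ht, hD, hδ]; ring
  obtain ⟨x, hx⟩ : ∃ x : ℚ,
    x = -4 * (4 * (n : ℚ) ^ 2 + n - 1) * (4 * (n : ℚ) ^ 2 + n - 2) * (n : ℚ) ^ 2 - a * b := ⟨_, rfl⟩
  have hq1 : x + a * b = (2 * N) ^ 2 * (-(α * β)) := by
    rw [hx, hα, hβ, ← hN]; ring
  have hq2 : x + a * c = (2 * v) ^ 2 * (-(N * α * (2 * N + 1))) := by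
    rw [hx, ← hN, ha, hb, hc, hα]
    linear_combination -4 * N * (4 * N ^ 2 + N - 1) * (2 * N + 1) * hnv'
  have hA0 : 0 < a * c - a * b := by rw [hA]; positivity
  have hB0 : 0 < b * c - a * b := by rw [hB]; positivity
  have hAB0 : 0 < b * c - a * c := by rw [hAB]; positivity
  have hκ1 : 3 * (-(a * b)) ^ 2 + 2 * (inducedCurve a b c).a₂ * (-(a * b)) +
      (inducedCurve a b c).a₄ = (a * c - a * b) * (b * c - a * b) := by
    simp only [inducedCurve]; ring
  have hκ2 : 3 * (-(a * c)) ^ 2 + 2 * (inducedCurve a b c).a₂ * (-(a * c)) +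
      (inducedCurve a b c).a₄ = -((a * c - a * b) * (b * c - a * c)) := by
    simp only [inducedCurve]; ring
  have d1 := @isSquare_descentValue_add_three ℚ _ _ (inducedCurve a b c).toAffine (-(a * b)) rfl rfl
    (by simp only [inducedCurve]; ring) (by rw [hκ1]; positivity)
  have d2 := @isSquare_descentValue_add_three ℚ _ _ (inducedCurve a b c).toAffine (-(a * c)) rfl rfl
    (by simp only [inducedCurve]; ring) (by rw [hκ2]; exact neg_ne_zero.2 (by positivity))
  have hP1 : descentValue (inducedCurve a b c).toAffine (-(a * b)) (Point.some _ _ hP) = a * b := by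
    have : 0 < a * b := by rw [hab]; positivity
    rw [descentValue_some _ (by linarith)]; ring
  have hP2 : descentValue (inducedCurve a b c).toAffine (-(a * c)) (Point.some _ _ hP) = a * c := by
    have : 0 < a * c := by rw [hac]; positivity
    rw [descentValue_some _ (by linarith)]; ring
  have hR1 : descentValue (inducedCurve a b c).toAffine (-(a * b)) (Point.some _ _ hR) =
      r * s + r * t + s * t + 1 + a * b := by
    have : 0 < r * s + r * t + s * t + 1 + a * b := by rw [hx1]; positivity
    rw [descentValue_some _ (by linarith)]; ring
  have hR2 : descentValue (inducedCurve a b c).toAffine (-(a * c)) (Point.some _ _ hR) =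
      r * s + r * t + s * t + 1 + a * c := by
    have : 0 < r * s + r * t + s * t + 1 + a * c := by rw [hx2]; positivity
    rw [descentValue_some _ (by linarith)]; ring
  have hQ1 : descentValue (inducedCurve a b c).toAffine (-(a * b)) (Point.some _ _ hQ) =
      x + a * b := by
    have : 0 < -(x + a * b) := by rw [hq1, mul_neg, neg_neg]; positivity
    rw [descentValue_some _ (by rw [← hx]; linarith), ← hx]; ring
  have hQ2 : descentValue (inducedCurve a b c).toAffine (-(a * c)) (Point.some _ _ hQ) =
      x + a * c := by
    have : 0 < -(x + a * c) := by rw [hq2, mul_neg, neg_neg]; positivity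
    rw [descentValue_some _ (by rw [← hx]; linarith), ← hx]; ring
  -- The square classes of the 2-torsion points; those of `(-bc, 0)` are the products of those of
  -- `(-ab, 0)` and `(-ac, 0)`.
  have htors : ∀ T : (inducedCurve a b c).toAffine.Point, T + T = 0 → ∃ j k : ℕ, j < 2 ∧ k < 2 ∧
      (j = 0 → k = 0 → T = 0) ∧
      (∃ z ≠ 0, descentValue (inducedCurve a b c).toAffine (-(a * b)) T =
        z ^ 2 * (((N + 1) * α * β * γ * δ) ^ j * (-(N * α * δ)) ^ k)) ∧
      ∃ z ≠ 0, descentValue (inducedCurve a b c).toAffine (-(a * c)) T =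
        z ^ 2 * ((N * α * δ) ^ j * (-(α * δ * D * (2 * N - 1) * (2 * N + 1))) ^ k) := by
    intro T hT
    rcases inducedCurve_eq_of_add_self_eq_zero hT with rfl | ⟨x, h, rfl, rfl | rfl | rfl⟩
    · exact ⟨0, 0, two_pos, two_pos, fun _ _ ↦ rfl, ⟨1, one_ne_zero, by simp [descentValue_zero]⟩,
        1, one_ne_zero, by simp [descentValue_zero]⟩
    · refine ⟨1, 0, one_lt_two, two_pos, fun h ↦ absurd h one_ne_zero,
        ⟨4 * N * u, by positivity, ?_⟩, 2 * u, by positivity, ?_⟩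
      · rw [descentValue_some_self, hκ1, hA, hB]; ring
      · rw [descentValue_some _ (by linarith), neg_sub_neg, hA]; ring
    · refine ⟨0, 1, two_pos, one_lt_two, fun _ h ↦ absurd h one_ne_zero,
        ⟨2 * u, by positivity, ?_⟩, 8 * N * u, by positivity, ?_⟩
      · rw [descentValue_some _ (by linarith), neg_sub_neg, ← neg_sub, hA]; ring
      · rw [descentValue_some_self, hκ2, hA, hAB]; ring
    · refine ⟨1, 1, one_lt_two, one_lt_two, fun h ↦ absurd h one_ne_zero,
        ⟨2 / (α * δ), by positivity, ?_⟩, 4 / (α * δ), by positivity, ?_⟩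
      · rw [descentValue_some _ (by linarith), neg_sub_neg, ← neg_sub, hB]; field_simp
      · rw [descentValue_some _ (by linarith), neg_sub_neg, ← neg_sub, hAB]; field_simp
  refine linearIndependent_int_of_descent _ fun ε T U hε hT h ↦ ?_
  simp only [Fin.sum_univ_three, Matrix.cons_val] at h
  obtain ⟨j, k, hj, hk, hjk, ⟨z₁, hz₁, hT1⟩, z₂, hz₂, hT2⟩ := htors T hT
  have e1 := d1 h
  have e2 := d2 h
  rw [descentValue_nsmul (hε 0), descentValue_nsmul (hε 1), descentValue_nsmul (hε 2)] at e1 e2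
  rw [hP1, hR1, hQ1, hT1, hx1, hq1, hab] at e1
  rw [hP2, hR2, hQ2, hT2, hx2, hq2, hac] at e2
  -- Removal of the square factors from both values.
  have sq_out : ∀ A₁ A₂ A₃ A₄ k₁ k₂ k₃ k₄ : ℚ, (A₁ ^ 2 * k₁) ^ ε 0 * (A₂ ^ 2 * k₂) ^ ε 1 *
      (A₃ ^ 2 * k₃) ^ ε 2 * (A₄ ^ 2 * k₄) =
      (A₁ ^ ε 0 * A₂ ^ ε 1 * A₃ ^ ε 2 * A₄) ^ 2 * (k₁ ^ ε 0 * k₂ ^ ε 1 * k₃ ^ ε 2 * k₄) := by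
    intros
    ring
  have f1 := isSquare_of_isSquare_sq_mul (by positivity) e1 (sq_out _ _ _ _ _ _ _ _)
  have f2 := isSquare_of_isSquare_sq_mul (by positivity) e2 (sq_out _ _ _ _ _ _ _ _)
  rw [hα, hβ, hγ, hδ, hN] at f1
  rw [hα, hδ, hD, hN] at f2
  obtain ⟨h0, h1, h2, rfl, rfl⟩ := descent_arithmetic hu hn rfl rfl rfl rfl rfl
    (hε 0) (hε 1) (hε 2) hj hk (by rw [← Rat.isSquare_intCast_iff]; exact_mod_cast f1)
    (by rw [← Rat.isSquare_intCast_iff]; exact_mod_cast f2)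
  exact ⟨by simp [Fin.forall_fin_succ, h0, h1, h2], hjk rfl rfl⟩

theorem mainTheorem8 (i : ℕ) (hi : 0 < i) (hsq : IsSquare (i * (3 * i + 1)))
    (a b c X : ℚ)
    (ha : a = 2 * ((i : ℚ) + 1) * i)
    (hb : b = 2 * ((i : ℚ) + 2) * (i + 1))
    (hc : c = 4 * (2 * (i : ℚ) ^ 2 + 4 * i + 1) * (2 * i + 3) * (2 * i + 1))
    (hX : X = -4 * (4 * (i : ℚ) ^ 2 + 9 * i + 4) * (4 * (i : ℚ) ^ 2 + 9 * i + 3) *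
      ((i : ℚ) + 1) ^ 2) :
    (inducedCurve a b c).IsElliptic ∧
    (3 : Cardinal) ≤ Module.rank ℤ (inducedCurve a b c).toAffine.Point ∧
    ∃ r s t y : ℚ,
      b * c + 1 = r ^ 2 ∧ c * a + 1 = s ^ 2 ∧ a * b + 1 = t ^ 2 ∧
      (shiftedCurve a b c).toAffine.Equation X y ∧
      ∃ (hP : (inducedCurve a b c).toAffine.Nonsingular 0 (a * b * c))
        (hS : (inducedCurve a b c).toAffine.Nonsingular 1 (r * s * t))
        (hQ : (inducedCurve a b c).toAffine.Nonsingular (X - a * b) y),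
        LinearIndependent ℤ
          (![WeierstrassCurve.Affine.Point.some 0 (a * b * c) hP,
             WeierstrassCurve.Affine.Point.some 1 (r * s * t) hS,
             WeierstrassCurve.Affine.Point.some (X - a * b) y hQ] :
            Fin 3 → (inducedCurve a b c).toAffine.Point) := by
  -- The coprime factors of `i * (3 * i + 1)` are squares `u ^ 2` and `v ^ 2`.
  have hsqZ : IsSquare ((i : ℤ) * (3 * i + 1)) := by
    rw [← Int.isSquare_natCast_iff] at hsq
    exact_mod_cast hsq
  have hcop : IsCoprime (i : ℤ) (3 * i + 1) := ⟨-3, 1, by ring⟩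
  obtain ⟨u, hu0, hu⟩ : ∃ u : ℤ, 0 < u ∧ (i : ℤ) = u ^ 2 := by
    obtain ⟨u, hu⟩ := Int.isSquare_of_isCoprime_of_isSquare_mul (by omega) hcop hsqZ
    refine ⟨|u|, abs_pos.2 ?_, by rw [sq_abs, hu, sq]⟩
    rintro rfl
    omega
  obtain ⟨v, hv0, hv⟩ : ∃ v : ℤ, 0 < v ∧ (3 * i + 1 : ℤ) = v ^ 2 := by
    obtain ⟨v, hv⟩ := Int.isSquare_of_isCoprime_of_isSquare_mul (by omega) hcop.symm
      (by rwa [mul_comm])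
    refine ⟨|v|, abs_pos.2 ?_, by rw [sq_abs, hv, sq]⟩
    rintro rfl
    omega
  have huQ : (i : ℚ) = u ^ 2 := by exact_mod_cast hu
  have hvQ : 3 * (i : ℚ) + 1 = v ^ 2 := by exact_mod_cast hv
  obtain ⟨n, hn⟩ : ∃ n : ℤ, n = (i : ℤ) + 1 := ⟨_, rfl⟩
  have hnQ : (n : ℚ) = i + 1 := by rw [hn]; push_cast; ring
  have hi1 : (1 : ℚ) ≤ i := by exact_mod_cast hi
  have ha0 : 0 < a := by rw [ha]; positivity
  have hab0 : a < b := by rw [ha, hb]; nlinarith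
  have hbc0 : b < c := by
    rw [hb, hc, ← sub_pos, show 4 * (2 * (i : ℚ) ^ 2 + 4 * i + 1) * (2 * i + 3) * (2 * i + 1) -
      2 * ((i : ℚ) + 2) * (i + 1) = 32 * (i : ℚ) ^ 4 + 128 * i ^ 3 + 166 * i ^ 2 + 74 * i + 8 by ring]
    positivity
  have hE : (inducedCurve a b c).IsElliptic :=
    inducedCurve_isElliptic (by linarith) (by linarith) (by linarith) (by linarith) (by linarith)
      (by linarith)
  have ns : ∀ {x y : ℚ}, (inducedCurve a b c).toAffine.Equation x y →
      (inducedCurve a b c).toAffine.Nonsingular x y :=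
    fun h ↦ WeierstrassCurve.Affine.equation_iff_nonsingular.1 h
  obtain ⟨r, hr⟩ : ∃ r : ℚ, r = 8 * n ^ 3 + 4 * n ^ 2 - 4 * n - 1 := ⟨_, rfl⟩
  obtain ⟨s, hs⟩ : ∃ s : ℚ, s = 8 * n ^ 3 - 4 * n ^ 2 - 4 * n + 1 := ⟨_, rfl⟩
  obtain ⟨t, ht⟩ : ∃ t : ℚ, t = 2 * n ^ 2 - 1 := ⟨_, rfl⟩
  have hr2 : b * c + 1 = r ^ 2 := by rw [hb, hc, hr, hnQ]; ring
  have hs2 : c * a + 1 = s ^ 2 := by rw [ha, hc, hs, hnQ]; ring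
  have ht2 : a * b + 1 = t ^ 2 := by rw [ha, hb, ht, hnQ]; ring
  have hX' : X = -4 * (4 * (n : ℚ) ^ 2 + n - 1) * (4 * (n : ℚ) ^ 2 + n - 2) * (n : ℚ) ^ 2 := by
    rw [hX, hnQ]; ring
  obtain ⟨y, hy⟩ : ∃ y : ℚ, y = 8 * n ^ 2 * (4 * n ^ 2 + n - 1) * (4 * n ^ 2 + n - 2) *
    (2 * n + 1) * u * v := ⟨_, rfl⟩
  have hQ' : (shiftedCurve a b c).toAffine.Equation X y := by
    rw [shiftedCurve_equation_iff, hX, ha, hb, hc, hy, hnQ,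
      show ∀ w : ℚ, (w * u * v) ^ 2 = w ^ 2 * (u : ℚ) ^ 2 * (v : ℚ) ^ 2 from fun w ↦ by ring,
      ← huQ, ← hvQ]
    ring
  have hP := ns ((inducedCurve_equation_iff a b c 0 (a * b * c)).2 (by ring))
  have hS := ns ((inducedCurve_equation_iff a b c 1 (r * s * t)).2 (by
    rw [add_comm 1, add_comm 1, add_comm 1, ht2, hr2, mul_comm a c, hs2]; ring))
  have hQ := ns ((shiftedCurve_equation_iff_inducedCurve a b c X y).1 hQ')
  have hR := ns (inducedCurve_equation_half hr2 hs2 ht2)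
  have hn2 : (2 : ℚ) ≤ n := by rw [hnQ]; linarith
  have hr0 : 0 < r := by rw [hr]; nlinarith [pow_pos (by linarith : (0 : ℚ) < n) 3]
  have hs0 : 0 < s := by
    rw [hs, show 8 * (n : ℚ) ^ 3 - 4 * (n : ℚ) ^ 2 - 4 * n + 1 =
      4 * n * (2 * n + 1) * (n - 1) + 1 by ring]
    have : (0 : ℚ) ≤ n - 1 := by linarith
    have : (0 : ℚ) < n := by linarith
    positivity
  have ht0 : 0 < t := by rw [ht]; nlinarith
  have hRR := inducedCurve_half_add_half hr2 hs2 ht2 (by positivity) hR hS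
  have hli : LinearIndependent ℤ ![WeierstrassCurve.Affine.Point.some _ _ hP,
      WeierstrassCurve.Affine.Point.some _ _ hR, WeierstrassCurve.Affine.Point.some _ _ hQ] := by
    subst hX'
    exact linearIndependent_family hu0 hv0 (by rw [hn, hu]) (by rw [hn, ← hv]; ring)
      (by rw [ha, hnQ]; ring) (by rw [hb, hnQ]; ring) (by rw [hc, hnQ]; ring) hr hs ht hP hR hQ
  have hPSQ : LinearIndependent ℤ ![WeierstrassCurve.Affine.Point.some _ _ hP,
      WeierstrassCurve.Affine.Point.some _ _ hS, WeierstrassCurve.Affine.Point.some _ _ hQ] := by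
    rw [Fintype.linearIndependent_iff] at hli ⊢
    intro g hg
    have h := hli ![g 0, 2 * g 1, g 2] (by
      rw [← hg]
      simp only [Fin.sum_univ_three, Matrix.cons_val]
      rw [← hRR, two_mul, add_smul, smul_add])
    have h0 := h 0
    have h1 := h 1
    have h2 := h 2
    simp only [Matrix.cons_val] at h0 h1 h2
    simp only [Fin.forall_fin_succ, IsEmpty.forall_iff, and_true]
    exact ⟨h0, by simpa using h1, h2⟩
  exact ⟨hE, by simpa using hli.cardinal_le_rank, r, s, t, y, hr2, hs2, ht2, hQ', hP, hS, hQ, hPSQ⟩
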